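/- Let $X$ be a homogeneous quasi-skip-free continuous-time Markov process, skip-free to the left, on the states $(m,i)$ with level $m\in\{0,-1,-2,\dots\}$ and phase $i\in\{0,\dots,\ell\}$, where $0\le\ell\le\infty$ (for $\ell=\infty$ the phases form a countably infinite set). That is, $X$ is the minimal process of a $q$-matrix $Q$ whose only transitions are the following: a matrix $D$ gives the rates from level $m$ to level $m-1$ for every $m\le 0$; $W$ gives the rates within level $m$ for $m<0$; $U^s$ gives the rates from level $m$ to level $m+s$ for $s\ge1$ and $m+s<0$; $U'^{k}$ gives the rates from level $-k$ to level $0$ for $k\ge1$; and $W'$ gives the rates within level $0$. Assume that $Q$ is stable, conservative, irreducible and non-explosive (the rates may be unbounded), and that $D=c\cdot r$ for a column vector $c$ and a row vector $r$, i.e. $d_{ij}=c_ir_j$. Let $T_{ij}$ be the expected total time spent in state $(m-1,j)$ before entering the set of levels $\ge m$, when $X$ starts in $(m-1,i)$; by homogeneity this does not depend on $m\le0$, so take $m=0$. Put $\hat t_j=\sum_i r_iT_{ij}$ and $\gamma=\hat t\cdot c=\sum_j\hat t_jc_j$. Then all $T_{ij}$ are finite, the series $\hat t_j$ converge absolutely,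 and: 1. If $\gamma<1$ and $\ell<\infty$, then $X$ is positive recurrent (every state has finite expected return time). 2. If $X$ is positive recurrent, then the series $\gamma$ converges absolutely and $\gamma<1$. In either case $X$ has exactly one stationary distribution $\pi$ (a probability distribution with $\pi P_t=\pi$ for all $t\ge0$, where $P_t$ is the transition function of $X$), the series $\sum_i\pi_{(0,i)}c_i$ converges absolutely, and $$\pi_{(m,j)}=\gamma^{-(m+1)}\Big(\sum_i\pi_{(0,i)}c_i\Big)\hat t_j\qquad\text{for all levels } m\le-1\text{ and all phases } j,$$ with the convention $\gamma^0=1$. -/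

import Mathlib

open scoped ENNReal
open MeasureTheory

noncomputable section

namespace QSF

section General

variable {S : Type*}

/-- A stable and conservative `q`-matrix: nonnegative rates off the diagonal, finite
diagonal (automatic, the entries are real), and every row sums to zero. -/
structure IsQMatrix (Q : Matrix S S ℝ) : Prop where
  nonneg : ∀ x y, x ≠ y → 0 ≤ Q x y
  hasSum_row : ∀ x, HasSum (fun y => Q x y) 0

/-- Every state can be reached from every state along jumps of positive rate. -/
def IsIrreducible (Q : Matrix S S ℝ) : Prop :=
  ∀ x y, Relation.ReflTransGen (fun u v => u ≠ v ∧ 0 < Q u v) x y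

open Classical in
/-- The jump rate from `x` to `z`, with the diagonal removed. -/
def rate (Q : Matrix S S ℝ) (x z : S) : ℝ≥0∞ :=
  if z = x then 0 else ENNReal.ofReal (Q x z)

open Classical in
/-- `nJump Q n t x y` is the probability that the minimal process with (possibly
non-conservative) `q`-matrix `Q`, started in `x`, has made exactly `n` jumps up to time `t ≥ 0`
and is in `y` at time `t`. The recursion conditions on the time `s` of the first jump and on the
state `z` reached by it. -/
def nJump (Q : Matrix S S ℝ) : ℕ → ℝ → S → S → ℝ≥0∞
  | 0, t, x, y => if x = y then ENNReal.ofReal (Real.exp (Q x x * t)) else 0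
  | n + 1, t, x, y =>
      ∫⁻ s in Set.Ioc 0 t,
        ENNReal.ofReal (Real.exp (Q x x * s)) * ∑' z, rate Q x z * nJump Q n (t - s) z y

/-- The (Feller) minimal transition function `P_t(x, y)`, `t ≥ 0`, of the `q`-matrix `Q`. -/
def minTrans (Q : Matrix S S ℝ) (t : ℝ) (x y : S) : ℝ≥0∞ :=
  ∑' n, nJump Q n t x y

/-- The minimal process is non-explosive: its transition function is honest. -/
def IsNonExplosive (Q : Matrix S S ℝ) : Prop :=
  ∀ t : ℝ, 0 ≤ t → ∀ x, ∑' y, minTrans Q t x y = 1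

/-- The transition function with taboo set `A`: the minimal transition function of
the `q`-matrix restricted to the complement of `A`. -/
def tabooTrans (Q : Matrix S S ℝ) (A : Set S) (t : ℝ) (x y : ↥Aᶜ) : ℝ≥0∞ :=
  minTrans (Q.submatrix (Subtype.val : ↥Aᶜ → S) Subtype.val) t x y

/-- The expected amount of time spent in `y` before entering `A`, starting in `x`. -/
def tabooTime (Q : Matrix S S ℝ) (A : Set S) (x y : ↥Aᶜ) : ℝ≥0∞ :=
  ∫⁻ t in Set.Ioi 0, tabooTrans Q A t x y

/-- The expected hitting time of `A` from `x ∉ A` for a non-explosive process, as the integral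
over `t` of the probability `∑_y tabooTrans Q A t x y` that `A` has not been entered by time `t`. -/
def meanHit (Q : Matrix S S ℝ) (A : Set S) (x : ↥Aᶜ) : ℝ≥0∞ :=
  ∫⁻ t in Set.Ioi 0, ∑' y, tabooTrans Q A t x y

/-- The expected return time to `x` of a non-explosive process: the mean sojourn time `1 / q_x`
plus the mean hitting time of `x` from the state to which the process jumps from `x`. -/
def meanReturn (Q : Matrix S S ℝ) (x : S) : ℝ≥0∞ :=
  (ENNReal.ofReal (-Q x x))⁻¹ +
    ∑' z : ↥({x}ᶜ : Set S),
      ENNReal.ofReal (Q x z) / ENNReal.ofReal (-Q x x) * meanHit Q {x} z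

/-- Positive recurrence of a non-explosive process: every state has a finite expected
return time. -/
def IsPositiveRecurrent (Q : Matrix S S ℝ) : Prop :=
  ∀ x, meanReturn Q x < ∞

/-- `p` is a stationary distribution of the minimal process with `q`-matrix `Q`: a probability
distribution with `p P_t = p` for all `t ≥ 0`. -/
structure IsStationary (Q : Matrix S S ℝ) (p : S → ℝ) : Prop where
  nonneg : ∀ x, 0 ≤ p x
  hasSum_one : HasSum p 1
  invariant : ∀ t : ℝ, 0 ≤ t → ∀ y,
    ∑' x, ENNReal.ofReal (p x) * minTrans Q t x y = ENNReal.ofReal (p y)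

end General

section Levels

variable {ι : Type*}

/-- The generator of a homogeneous quasi-skip-free process, skip-free to the left, with levels
`m = 0, -1, -2, …` and phases `ι`. The state `(m, i)` is encoded as `(n, i)` with `n = -m`, so a
jump one level down (to the left) raises `n` by one. `D` holds the rates to the next lower level,
`W` those within a level `m < 0`, `U s` (`s ≥ 1`) those from a level to the `s`-th higher level
when that is below level `0`, `U' k` (`k ≥ 1`) those from level `-k` to level `0`, and `W'`
those within level `0`. (`U 0` and `U' 0` are not used.) -/
def generator (D W W' : Matrix ι ι ℝ) (U U' : ℕ → Matrix ι ι ℝ) :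
    Matrix (ℕ × ι) (ℕ × ι) ℝ := fun x y =>
  if x.1 + 1 < y.1 then 0
  else if y.1 = x.1 + 1 then D x.2 y.2
  else if y.1 = 0 then (if x.1 = 0 then W' x.2 y.2 else U' x.1 x.2 y.2)
  else if y.1 = x.1 then W x.2 y.2
  else U (x.1 - y.1) x.2 y.2

/-- Level `0`. -/
def topLevel (ι : Type*) : Set (ℕ × ι) := {x | x.1 = 0}

/-- The state `(-1, i)`, as a state outside level `0`. -/
def below (i : ι) : ↥(topLevel ι)ᶜ := ⟨(1, i), by simp [topLevel]⟩

/-- The expected time spent in `(m-1, j)` before entering the levels `≥ m`, starting in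
`(m-1, i)`, taken at `m = 0`. By homogeneity it is the same for all levels `m ≤ 0`. -/
def levelTime (Q : Matrix (ℕ × ι) (ℕ × ι) ℝ) (i j : ι) : ℝ≥0∞ :=
  tabooTime Q (topLevel ι) (below i) (below j)

/-- The matrix `T` of the expected times `levelTime`, as real numbers. -/
def T (Q : Matrix (ℕ × ι) (ℕ × ι) ℝ) : Matrix ι ι ℝ := fun i j => (levelTime Q i j).toReal

/-- The row vector `t̂ = r · T`. -/
def tHat (Q : Matrix (ℕ × ι) (ℕ × ι) ℝ) (r : ι → ℝ) (j : ι) : ℝ := ∑' i, r i * T Q i j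

/-- The number `γ = t̂ · c`. -/
def gamma (Q : Matrix (ℕ × ι) (ℕ × ι) ℝ) (c r : ι → ℝ) : ℝ := ∑' j, tHat Q r j * c j

end Levels

end QSF

end

/-! Fix a state `a` and let `μ y = occTime Q {a} a y` be the expected time spent in `y` during one
excursion from `a`. It is finite (`occTime_ne_top`), its total mass is the mean return time to `a`
(`meanReturn_eq_tsum_occTime`), and it is subinvariant for `Q` (`tsum_occTime_mul_rate_le`).

Decompose an excursion at its last exit from the levels `≥ -n` (`occTime_last_exit`). If `a` lies in
these levels, skip-freeness forces the exit to be a jump from `(-n, i)` to `(-(n+1), k)`, of rate `c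
i * r k`, and by homogeneity the time then spent in `(-(n+1), j)` before returning is `T k j`. Since
the rate factors, `μ` on level `-(n+1)` is the scalar `∑ i, μ (-n, i) * c i` times `t̂`
(`occTime_next_level`), so from one level to the next this scalar is multiplied by `γ`
(`downFlow_add`). The mass of `μ` below `a` is thus a geometric series in `γ`: with finitely many
phases `γ < 1` makes it finite, and conversely a finite mass forces `γ < 1`.

When the mass is finite, normalise `μ`. Subinvariance passes to the minimal transition function,
which is honest, so no mass is lost and the inequality is an equality
(`isStationary_of_subinvariant`). Uniqueness follows by comparing two stationary distributions with
their minimum.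

No paths are constructed: everything is expanded over the number of jumps. Sums live in `ℝ≥0∞`, with
`|c|` and `|r|` in place of `c` and `r`, whose common sign cancels at the end. -/

namespace QSF

/-! ### Jump expansion of the transition function as convolutions -/

section JumpDensity

variable {S : Type*}

/-- The exit rate `q_x` of the state `x`. -/
noncomputable def exitRate (Q : Matrix S S ℝ) (x : S) : ℝ≥0∞ := ENNReal.ofReal (-Q x x)

/-- The survival function of the holding time in `x`, extended by zero to `t ≤ 0`. -/
noncomputable def holding (Q : Matrix S S ℝ) (x : S) : ℝ → ℝ≥0∞ :=
  (Set.Ioi 0).indicator fun t => ENNReal.ofReal (Real.exp (Q x x * t))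

/-- The function `t ↦ nJump Q n t x y`, extended by zero to `t ≤ 0`. -/
noncomputable def jumpProb (Q : Matrix S S ℝ) (n : ℕ) (x y : S) : ℝ → ℝ≥0∞ :=
  (Set.Ioi 0).indicator fun t => nJump Q n t x y

lemma measurable_holding (Q : Matrix S S ℝ) (x : S) : Measurable (holding Q x) := by
  unfold holding
  refine Measurable.indicator ?_ measurableSet_Ioi
  fun_prop

open Classical in
lemma jumpProb_zero (Q : Matrix S S ℝ) (x y : S) :
    jumpProb Q 0 x y = if x = y then holding Q x else 0 := by
  ext t
  by_cases h : x = y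
  · simp only [jumpProb, holding, nJump, if_pos h]
  · simp [jumpProb, nJump, if_neg h]

lemma jumpProb_succ_aux (Q : Matrix S S ℝ) (n : ℕ) (x y : S) (t : ℝ) :
    jumpProb Q (n + 1) x y t =
      ∫⁻ s, ∑' z, rate Q x z * (holding Q x s * jumpProb Q n z y (-s + t)) := by
  by_cases ht : 0 < t
  · have hr : jumpProb Q (n + 1) x y t = nJump Q (n + 1) t x y := by
      simp [jumpProb, ht]
    -- The endpoint `s = t` must be dropped: `jumpProb` vanishes at time `0`, where `nJump` need
    -- not.
    rw [hr, nJump, setLIntegral_congr Ioo_ae_eq_Ioc.symm, ← lintegral_indicator measurableSet_Ioo]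
    congr 1 with s
    by_cases hs : 0 < s
    · by_cases hst : s < t
      · have h1 : 0 < -s + t := by linarith
        have h2 : t - s = -s + t := by ring
        simp only [Set.indicator, Set.mem_Ioo, hs, hst, and_self, if_true, holding, jumpProb,
          Set.mem_Ioi, h1, h2, ← ENNReal.tsum_mul_left]
        exact tsum_congr fun z => by ring
      · have h1 : ¬ (0 < -s + t) := by linarith
        simp [Set.indicator, hst, jumpProb, h1]
    · simp [Set.indicator, hs, holding]
  · have h : ∀ s z, rate Q x z * (holding Q x s * jumpProb Q n z y (-s + t)) = 0 := by
      intro s z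
      by_cases hs : 0 < s
      · have h1 : ¬ (0 < -s + t) := by linarith
        simp [jumpProb, h1]
      · simp [holding, hs]
    simp only [h, tsum_zero, lintegral_zero]
    simp [jumpProb, ht]

lemma exitRate_mul_holding {Q : Matrix S S ℝ} {x : S} :
    (fun t => exitRate Q x * holding Q x t) =ᵐ[volume]
      ProbabilityTheory.exponentialPDF (-Q x x) := by
  have h0 : ∀ᵐ t : ℝ, t ≠ 0 := by
    simp [ae_iff, measure_singleton]
  filter_upwards [h0] with t ht
  by_cases h : 0 < t
  · rw [ProbabilityTheory.exponentialPDF_of_nonneg h.le, ENNReal.ofReal_mul' (Real.exp_nonneg _)]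
    simp [holding, h, exitRate]
  · rw [ProbabilityTheory.exponentialPDF_of_neg (lt_of_le_of_ne (not_lt.mp h) ht)]
    simp [holding, h]

lemma lintegral_holding {Q : Matrix S S ℝ} {x : S} (hx : Q x x < 0) :
    ∫⁻ t, holding Q x t = (exitRate Q x)⁻¹ := by
  refine ENNReal.eq_inv_of_mul_eq_one_left ?_
  rw [mul_comm, ← lintegral_const_mul _ (measurable_holding Q x),
    lintegral_congr_ae exitRate_mul_holding]
  exact ProbabilityTheory.lintegral_exponentialPDF_eq_one (by linarith)

/-- Survival probability plus distribution function of the exponential holding time. -/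
lemma holding_add_lintegral_holding {Q : Matrix S S ℝ} {x : S} (hx : Q x x < 0) {t : ℝ}
    (ht : 0 < t) : holding Q x t + exitRate Q x * ∫⁻ s in Set.Iic t, holding Q x s = 1 := by
  rw [← lintegral_const_mul _ (measurable_holding Q x),
    lintegral_congr_ae (ae_restrict_of_ae exitRate_mul_holding),
    ProbabilityTheory.lintegral_exponentialPDF_eq_antiDeriv (by linarith), if_pos ht.le]
  have h : Real.exp (Q x x * t) ≤ 1 := Real.exp_le_one_iff.mpr (by nlinarith)
  simp only [holding, Set.indicator, Set.mem_Ioi, ht, if_true, neg_mul, neg_neg]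
  rw [← ENNReal.ofReal_add (Real.exp_nonneg _) (by linarith)]
  simp

variable [Countable S]

lemma measurable_jumpProb (Q : Matrix S S ℝ) (n : ℕ) (x y : S) : Measurable (jumpProb Q n x y) := by
  induction n generalizing x y with
  | zero =>
    rw [jumpProb_zero]
    split_ifs
    · exact measurable_holding Q x
    · exact measurable_zero
  | succ n ih =>
    rw [funext (jumpProb_succ_aux Q n x y)]
    have := measurable_holding Q x
    refine Measurable.lintegral_prod_right' (f := fun p : ℝ × ℝ =>
      ∑' z, rate Q x z * (holding Q x p.2 * jumpProb Q n z y (-p.2 + p.1))) ?_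
    exact Measurable.tsum fun z => by have := ih z y; fun_prop

lemma jumpProb_succ (Q : Matrix S S ℝ) (n : ℕ) (x y : S) :
    jumpProb Q (n + 1) x y = fun t => ∑' z, rate Q x z * (holding Q x ⋆ₗ jumpProb Q n z y) t := by
  ext t
  rw [jumpProb_succ_aux, lintegral_tsum]
  · refine tsum_congr fun z => ?_
    rw [lintegral_const_mul, lconvolution_def]
    have := measurable_holding Q x
    have := measurable_jumpProb Q n z y
    fun_prop
  · intro z
    have := measurable_holding Q x
    have := measurable_jumpProb Q n z y
    fun_prop

lemma tsum_lconvolution {α : Type*} [Countable α] (f : α → ℝ → ℝ≥0∞) (g : ℝ → ℝ≥0∞) (a : α → ℝ≥0∞)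
    (hf : ∀ i, Measurable (f i)) (hg : Measurable g) :
    ((fun t => ∑' i, a i * f i t) ⋆ₗ g) = fun t => ∑' i, a i * (f i ⋆ₗ g) t := by
  ext t
  simp only [lconvolution_def, ← ENNReal.tsum_mul_right]
  rw [lintegral_tsum]
  · refine tsum_congr fun z => ?_
    simp only [mul_assoc]
    rw [lintegral_const_mul]
    have := hf z
    fun_prop
  · intro z
    have := hf z
    fun_prop

lemma lconvolution_tsum {α : Type*} [Countable α] (f : α → ℝ → ℝ≥0∞) (g : ℝ → ℝ≥0∞) (a : α → ℝ≥0∞)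
    (hf : ∀ i, Measurable (f i)) (hg : Measurable g) :
    (g ⋆ₗ fun t => ∑' i, a i * f i t) = fun t => ∑' i, a i * (g ⋆ₗ f i) t := by
  rw [lconvolution_comm, tsum_lconvolution f g a hf hg]
  simp only [lconvolution_comm (f := g)]

/-- The recursion for `jumpProb` which conditions on the last jump. -/
lemma jumpProb_succ' (Q : Matrix S S ℝ) (n : ℕ) (x y : S) :
    jumpProb Q (n + 1) x y = fun t => ∑' z, rate Q z y * (jumpProb Q n x z ⋆ₗ holding Q y) t := by
  classical
  induction n generalizing x y with
  | zero =>
    rw [jumpProb_succ]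
    ext t
    simp only [jumpProb_zero]
    rw [tsum_eq_single y, tsum_eq_single x]
    · simp
    · intro z hz
      simp [hz.symm]
    · intro z hz
      simp [hz]
  | succ n ih =>
    have hE := measurable_holding Q
    have hN := measurable_jumpProb Q n
    rw [jumpProb_succ]
    -- Splitting off both the first jump (to `z`) and the last (from `w`) turns either side into the
    -- same double sum of triple convolutions.
    have h1 : ∀ z, (holding Q x ⋆ₗ jumpProb Q (n + 1) z y) =
        fun t => ∑' w, rate Q w y * ((holding Q x ⋆ₗ jumpProb Q n z w) ⋆ₗ holding Q y) t := by
      intro z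
      rw [ih, lconvolution_tsum]
      · simp only [lconvolution_assoc (hE x) (hN z _) (hE y)]
      · exact fun w => measurable_lconvolution _ (hN z w) (hE y)
      · exact hE x
    have h2 : ∀ w, (jumpProb Q (n + 1) x w ⋆ₗ holding Q y) =
        fun t => ∑' z, rate Q x z * ((holding Q x ⋆ₗ jumpProb Q n z w) ⋆ₗ holding Q y) t := by
      intro w
      rw [jumpProb_succ, tsum_lconvolution]
      · exact fun z => measurable_lconvolution _ (hE x) (hN z w)
      · exact hE y
    ext t
    simp only [h1, h2, ← ENNReal.tsum_mul_left]
    rw [ENNReal.tsum_comm]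
    exact tsum_congr fun w => tsum_congr fun z => by ring

lemma lintegral_lconvolution (f g : ℝ → ℝ≥0∞) (hf : Measurable f) (hg : Measurable g) :
    ∫⁻ t, (f ⋆ₗ g) t = (∫⁻ t, f t) * ∫⁻ t, g t := by
  simp only [lconvolution_def]
  rw [lintegral_lintegral_swap (by fun_prop), ← lintegral_mul_const _ hf]
  congr 1 with s
  rw [lintegral_const_mul _ (by fun_prop)]
  congr 1
  exact lintegral_add_left_eq_self g (-s)

lemma lintegral_jumpProb_succ (Q : Matrix S S ℝ) (n : ℕ) (x y : S) :
    ∫⁻ t, jumpProb Q (n + 1) x y t =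
      (∫⁻ t, holding Q x t) * ∑' z, rate Q x z * ∫⁻ t, jumpProb Q n z y t := by
  have hE := measurable_holding Q
  have hN := measurable_jumpProb Q n
  rw [jumpProb_succ, lintegral_tsum]
  · rw [← ENNReal.tsum_mul_left]
    refine tsum_congr fun z => ?_
    rw [lintegral_const_mul _ (measurable_lconvolution _ (hE x) (hN z y)),
      lintegral_lconvolution _ _ (hE x) (hN z y)]
    ring
  · exact fun z => ((measurable_lconvolution _ (hE x) (hN z y)).const_mul _).aemeasurable

end JumpDensity

/-! ### Occupation times, balance equations and last-exit decomposition -/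

section Occupation

variable {S : Type*}

open Classical in
/-- The expected time spent in `y` between the `n`-th and the next jump, on the event that none of
the first `n` jumps leads into `B`, when starting in `x` (which may belong to `B`). -/
noncomputable def stepTime (Q : Matrix S S ℝ) (B : Set S) : ℕ → S → S → ℝ≥0∞
  | 0, x, y => if x = y then (exitRate Q x)⁻¹ else 0
  | n + 1, x, y =>
      (exitRate Q x)⁻¹ * ∑' z, Bᶜ.indicator (fun z => rate Q x z * stepTime Q B n z y) z

/-- The expected time spent in `y` before the first jump into `B`, when starting in `x`. -/
noncomputable def occTime (Q : Matrix S S ℝ) (B : Set S) (x y : S) : ℝ≥0∞ :=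
  ∑' n, stepTime Q B n x y

lemma rate_submatrix (Q : Matrix S S ℝ) (B : Set S) (x z : ↥Bᶜ) :
    rate (Q.submatrix Subtype.val Subtype.val) x z = rate Q x z := by
  classical
  simp only [rate, Subtype.ext_iff, Matrix.submatrix_apply]

lemma exitRate_ne_zero {Q : Matrix S S ℝ} (hq : ∀ x, Q x x < 0) (x : S) : exitRate Q x ≠ 0 := by
  have := hq x
  simpa [exitRate]

lemma exitRate_ne_top (Q : Matrix S S ℝ) (x : S) : exitRate Q x ≠ ∞ := ENNReal.ofReal_ne_top

lemma lintegral_jumpProb_submatrix [Countable S] {Q : Matrix S S ℝ} (hq : ∀ x, Q x x < 0)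
    (B : Set S) (n : ℕ) (x y : ↥Bᶜ) :
    ∫⁻ t, jumpProb (Q.submatrix Subtype.val Subtype.val) n x y t = stepTime Q B n x y := by
  classical
  induction n generalizing x with
  | zero =>
    rw [jumpProb_zero, stepTime]
    simp only [← Subtype.ext_iff]
    split_ifs
    · exact lintegral_holding (hq x)
    · simp
  | succ n ih =>
    rw [lintegral_jumpProb_succ, lintegral_holding (by exact hq x), stepTime]
    simp only [ih, rate_submatrix]
    congr 1
    exact tsum_subtype Bᶜ (fun z => rate Q x z * stepTime Q B n z y)

lemma tabooTime_eq_occTime [Countable S] {Q : Matrix S S ℝ} (hq : ∀ x, Q x x < 0)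
    (B : Set S) (x y : ↥Bᶜ) : tabooTime Q B x y = occTime Q B x y := by
  rw [occTime, tabooTime, ← lintegral_indicator measurableSet_Ioi]
  have h : (Set.Ioi 0).indicator (fun t => tabooTrans Q B t x y) =
      fun t => ∑' n, jumpProb (Q.submatrix (Subtype.val : ↥Bᶜ → S) Subtype.val) n x y t := by
    ext t
    by_cases ht : 0 < t <;> simp [ht, jumpProb, tabooTrans, minTrans]
  rw [h, lintegral_tsum fun n => (measurable_jumpProb _ n x y).aemeasurable]
  exact tsum_congr fun n => lintegral_jumpProb_submatrix hq B n x y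

lemma occTime_eq_add (Q : Matrix S S ℝ) (B : Set S) (x y : S) :
    occTime Q B x y = stepTime Q B 0 x y +
      (exitRate Q x)⁻¹ * ∑' z, Bᶜ.indicator (fun z => rate Q x z * occTime Q B z y) z := by
  rw [occTime, tsum_eq_zero_add' ENNReal.summable]
  congr 1
  simp only [stepTime]
  rw [ENNReal.tsum_mul_left, ENNReal.tsum_comm]
  congr 1
  refine tsum_congr fun z => ?_
  by_cases hz : z ∈ Bᶜ
  · simp only [Set.indicator_of_mem hz, ENNReal.tsum_mul_left, occTime]
  · simp only [Set.indicator_of_notMem hz, tsum_zero]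

lemma stepTime_succ_of_mem {Q : Matrix S S ℝ} {B : Set S} {y : S} (hy : y ∈ B) (n : ℕ) (x : S) :
    stepTime Q B (n + 1) x y = 0 := by
  induction n generalizing x with
  | zero =>
    rw [stepTime]
    convert mul_zero _
    refine ENNReal.tsum_eq_zero.mpr fun z => ?_
    by_cases hz : z ∈ B
    · simp [hz]
    · have : z ≠ y := fun h => hz (h ▸ hy)
      simp [stepTime, this]
  | succ n ih =>
    rw [stepTime]
    simp [ih]

lemma occTime_of_mem {Q : Matrix S S ℝ} {B : Set S} {y : S} (hy : y ∈ B) (x : S) :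
    occTime Q B x y = stepTime Q B 0 x y := by
  rw [occTime, tsum_eq_zero_add' ENNReal.summable]
  simp [stepTime_succ_of_mem hy]

lemma stepTime_eq_zero {Q : Matrix S S ℝ} {B : Set S} {x y : S} (hx : x ∉ B) (hy : y ∈ B) (n : ℕ) :
    stepTime Q B n x y = 0 := by
  cases n with
  | zero =>
    have : x ≠ y := fun h => hx (h ▸ hy)
    simp [stepTime, this]
  | succ n => exact stepTime_succ_of_mem hy n x

lemma tsum_occTime_eq_meanHit [Countable S] {Q : Matrix S S ℝ} (hq : ∀ x, Q x x < 0)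
    (B : Set S) (x : ↥Bᶜ) : ∑' y, occTime Q B x y = meanHit Q B x := by
  have h0 : ∀ y, y ∉ Bᶜ → occTime Q B x y = 0 := fun y hy => by
    simp [occTime, stepTime_eq_zero x.2 (not_not.mp hy)]
  rw [← tsum_subtype_eq_of_support_subset (s := Bᶜ) fun y hy => by_contra fun h => hy (h0 y h)]
  simp only [← tabooTime_eq_occTime hq]
  unfold meanHit tabooTime
  have hm : ∀ y, (Set.Ioi 0).indicator (fun t => tabooTrans Q B t x y) =
      fun t => ∑' n, jumpProb (Q.submatrix (Subtype.val : ↥Bᶜ → S) Subtype.val) n x y t := by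
    intro y
    ext t
    by_cases ht : 0 < t <;> simp [ht, jumpProb, tabooTrans, minTrans]
  rw [lintegral_tsum]
  intro y
  refine (aemeasurable_indicator_iff measurableSet_Ioi).mp ?_
  rw [hm]
  exact (Measurable.tsum fun n => measurable_jumpProb _ n x y).aemeasurable

/-- An excursion from `x` is split at its first jump. As `x` is itself taboo, it is counted only
during the initial sojourn. Positive recurrence thereby becomes finiteness of the mass of the
excursion measure. -/
lemma meanReturn_eq_tsum_occTime [Countable S] {Q : Matrix S S ℝ} (hq : ∀ x, Q x x < 0) (x : S) :
    meanReturn Q x = ∑' y, occTime Q {x} x y := by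
  classical
  simp only [occTime_eq_add Q {x} x]
  rw [ENNReal.tsum_add, ENNReal.tsum_mul_left, ENNReal.tsum_comm, meanReturn]
  congr 1
  · simp [stepTime, exitRate]
  · simp only [← tsum_occTime_eq_meanHit hq]
    rw [tsum_subtype ({x}ᶜ : Set S) (fun z => ENNReal.ofReal (Q x z) / ENNReal.ofReal (-Q x x) *
      ∑' y, occTime Q {x} z y), ← ENNReal.tsum_mul_left]
    refine tsum_congr fun z => ?_
    by_cases hz : z = x
    · simp [hz]
    · have hz' : z ∈ ({x}ᶜ : Set S) := hz
      simp only [Set.indicator_of_mem hz', rate, if_neg hz, ENNReal.tsum_mul_left]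
      rw [exitRate, div_eq_mul_inv]
      ring

-- Last-jump form of the recursion. It needs `y ∉ B`, since jumps into `B` are discarded on the
-- left.
open Classical in
lemma stepTime_succ' {Q : Matrix S S ℝ} {B : Set S} {y : S} (hy : y ∉ B) (n : ℕ) (x : S) :
    stepTime Q B (n + 1) x y = (∑' z, stepTime Q B n x z * rate Q z y) * (exitRate Q y)⁻¹ := by
  induction n generalizing x with
  | zero =>
    rw [stepTime, tsum_eq_single y, tsum_eq_single x]
    · simp [stepTime, hy]; ring
    · intro z hz
      simp [stepTime, hz.symm]
    · intro z hz
      simp [stepTime, hz]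
  | succ n ih =>
    rw [stepTime]
    simp only [ih]
    simp only [stepTime, ← ENNReal.tsum_mul_right, ← ENNReal.tsum_mul_left]
    rw [ENNReal.tsum_comm]
    refine tsum_congr fun z => ?_
    by_cases hz : z ∈ Bᶜ
    · simp only [Set.indicator_of_mem hz, ← ENNReal.tsum_mul_left]
      exact tsum_congr fun w => by ring
    · simp [Set.indicator_of_notMem hz]

lemma occTime_mul_exitRate {Q : Matrix S S ℝ} (hq : ∀ x, Q x x < 0) {B : Set S} {y : S}
    (hy : y ∉ B) (x : S) :
    occTime Q B x y * exitRate Q y =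
      stepTime Q B 0 x y * exitRate Q y + ∑' z, occTime Q B x z * rate Q z y := by
  rw [occTime, tsum_eq_zero_add' ENNReal.summable, add_mul]
  congr 1
  simp only [stepTime_succ' hy]
  rw [ENNReal.tsum_mul_right, mul_assoc,
    ENNReal.inv_mul_cancel (exitRate_ne_zero hq y) (exitRate_ne_top Q y), mul_one,
    ENNReal.tsum_comm]
  exact tsum_congr fun z => ENNReal.tsum_mul_right

lemma tsum_sum_antidiagonal (f : ℕ → ℕ → ℝ≥0∞) :
    ∑' n, ∑ p ∈ Finset.HasAntidiagonal.antidiagonal n, f p.1 p.2 = ∑' i, ∑' j, f i j := by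
  rw [← ENNReal.tsum_prod, ← Finset.HasAntidiagonal.sigmaAntidiagonalEquivProd.tsum_eq
    (fun p : ℕ × ℕ => f p.1 p.2), ENNReal.tsum_sigma']
  refine tsum_congr fun n => ?_
  rw [← Finset.tsum_subtype]
  rfl

/-- The path is cut at its last jump out of `A`, from `u` to `k`: `p.1` jumps precede it and `p.2`
follow. After the cut, avoiding `A` includes avoiding `B`, because `B ⊆ A`. -/
lemma stepTime_last_exit {Q : Matrix S S ℝ} {A B : Set S} (hBA : B ⊆ A) {x : S}
    (hx : x ∈ A) (n : ℕ) {y : S} (hy : y ∉ A) :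
    stepTime Q B (n + 1) x y = ∑ p ∈ Finset.HasAntidiagonal.antidiagonal n, ∑' k : ↥Aᶜ,
      (∑' u : A, stepTime Q B p.1 x u * rate Q u k) * stepTime Q A p.2 k y := by
  classical
  induction n generalizing y with
  | zero =>
    rw [stepTime_succ' (fun h => hy (hBA h))]
    simp only [Finset.Nat.antidiagonal_zero, Finset.sum_singleton]
    rw [tsum_eq_single (⟨y, hy⟩ : ↥Aᶜ), tsum_eq_single x, tsum_eq_single (⟨x, hx⟩ : A)]
    · simp [stepTime]
    · intro z hz
      have : x ≠ z := fun h => hz (Subtype.ext h.symm)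
      simp [stepTime, this]
    · intro z hz
      simp [stepTime, hz.symm]
    · intro z hz
      have : (z : S) ≠ y := fun h => hz (Subtype.ext h)
      simp [stepTime, this]
  | succ n ih =>
    rw [stepTime_succ' (fun h => hy (hBA h)),
      -- If the final jump starts in `A`, it is the exit itself, giving the term `(n + 1, 0)`;
      -- otherwise the induction hypothesis applies to its starting point.
      ← ENNReal.summable.tsum_add_tsum_compl (s := A) ENNReal.summable, add_mul,
      Finset.Nat.antidiagonal_succ', Finset.sum_cons, Finset.sum_map]
    congr 1
    · rw [tsum_eq_single (⟨y, hy⟩ : ↥Aᶜ)]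
      · simp [stepTime]
      · intro z hz
        have : (z : S) ≠ y := fun h => hz (Subtype.ext h)
        simp [stepTime, this]
    · simp only [Function.Embedding.coe_prodMap, Function.Embedding.refl_apply,
        Function.Embedding.coeFn_mk, Prod.map]
      have : ∀ z : ↥Aᶜ, stepTime Q B (n + 1) x z * rate Q z y = ∑ p ∈ Finset.HasAntidiagonal.antidiagonal n,
          ∑' k : ↥Aᶜ, (∑' u : A, stepTime Q B p.1 x u * rate Q u k) *
            stepTime Q A p.2 k z * rate Q z y := by
        intro z
        rw [ih z.2, Finset.sum_mul]
        simp only [ENNReal.tsum_mul_right]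
      simp only [this]
      rw [Summable.tsum_finsetSum fun _ _ => ENNReal.summable, Finset.sum_mul]
      refine Finset.sum_congr rfl fun p _ => ?_
      rw [ENNReal.tsum_comm, ← ENNReal.tsum_mul_right]
      refine tsum_congr fun k => ?_
      rw [Nat.succ_eq_add_one, stepTime_succ' hy]
      simp only [mul_assoc]
      rw [ENNReal.tsum_mul_left, mul_assoc]
      congr 2
      refine (tsum_subtype_eq_of_support_subset (s := Aᶜ)
        (f := fun z => stepTime Q A p.2 k z * rate Q z y) fun z hz => by_contra fun h => hz ?_)
      simp [stepTime_eq_zero k.2 (not_not.mp h)]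

lemma occTime_last_exit {Q : Matrix S S ℝ} {A B : Set S} (hBA : B ⊆ A) {x y : S}
    (hx : x ∈ A) (hy : y ∉ A) :
    occTime Q B x y =
      ∑' k : ↥Aᶜ, (∑' u : A, occTime Q B x u * rate Q u k) * occTime Q A k y := by
  classical
  have h0 : stepTime Q B 0 x y = 0 := by
    have : x ≠ y := fun h => hy (h ▸ hx)
    simp [stepTime, this]
  rw [occTime, tsum_eq_zero_add' ENNReal.summable, h0, zero_add]
  simp only [stepTime_last_exit hBA hx _ hy]
  rw [tsum_sum_antidiagonal (fun i j => ∑' k : ↥Aᶜ,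
      (∑' u : A, stepTime Q B i x u * rate Q u k) * stepTime Q A j k y)]
  have h1 : ∀ i, ∑' j, ∑' k : ↥Aᶜ,
      (∑' u : A, stepTime Q B i x u * rate Q u k) * stepTime Q A j k y =
      ∑' k : ↥Aᶜ, (∑' u : A, stepTime Q B i x u * rate Q u k) * occTime Q A k y := by
    intro i
    rw [ENNReal.tsum_comm]
    exact tsum_congr fun k => ENNReal.tsum_mul_left
  simp only [h1]
  rw [ENNReal.tsum_comm]
  refine tsum_congr fun k => ?_
  rw [ENNReal.tsum_mul_right, ENNReal.tsum_comm]
  simp only [ENNReal.tsum_mul_right]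
  rfl

end Occupation

/-! ### Finiteness and subinvariance of occupation times -/

section Bounds

variable {S : Type*}

lemma tsum_rate {Q : Matrix S S ℝ} (hQ : IsQMatrix Q) (x : S) :
    ∑' z, rate Q x z = exitRate Q x := by
  classical
  have h := (hQ.hasSum_row x).update x 0
  have hnn : ∀ z, 0 ≤ Function.update (Q x) x 0 z := by
    intro z
    by_cases hz : z = x
    · simp [hz]
    · simpa [hz] using hQ.nonneg x z (Ne.symm hz)
  have h2 := ENNReal.ofReal_tsum_of_nonneg hnn h.summable
  rw [h.tsum_eq] at h2
  simp only [zero_sub, add_zero] at h2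
  rw [exitRate, h2]
  refine tsum_congr fun z => ?_
  by_cases hz : z = x <;> simp [hz, rate]

lemma rate_ne_zero {Q : Matrix S S ℝ} {x z : S} (h : x ≠ z ∧ 0 < Q x z) : rate Q x z ≠ 0 := by
  classical
  simp [rate, Ne.symm h.1, h.2]

lemma diag_neg [Nontrivial S] {Q : Matrix S S ℝ} (hQ : IsQMatrix Q) (hirr : IsIrreducible Q)
    (x : S) : Q x x < 0 := by
  obtain ⟨y, hy⟩ := exists_ne x
  rcases Relation.ReflTransGen.cases_head (hirr x y) with h | ⟨z, hz, -⟩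
  · exact absurd h.symm hy
  · have h1 : exitRate Q x ≠ 0 := by
      rw [← tsum_rate hQ]
      exact fun h => rate_ne_zero hz (ENNReal.tsum_eq_zero.mp h z)
    simpa [exitRate] using h1

/-- First-jump equation truncated at finitely many jumps. Truncated times are known to be finite, so
they can be cancelled in inequalities. -/
lemma sum_stepTime_succ (Q : Matrix S S ℝ) (B : Set S) (n : ℕ) (x y : S) :
    ∑ k ∈ Finset.range (n + 1), stepTime Q B k x y = stepTime Q B 0 x y + (exitRate Q x)⁻¹ *
      ∑' z, rate Q x z * Bᶜ.indicator (fun z => ∑ k ∈ Finset.range n, stepTime Q B k z y) z := by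
  rw [Finset.sum_range_succ', add_comm]
  simp only [stepTime]
  rw [← Finset.mul_sum, ← Summable.tsum_finsetSum fun _ _ => ENNReal.summable]
  congr 2
  refine tsum_congr fun z => ?_
  by_cases hz : z ∈ Bᶜ
  · simp only [Set.indicator_of_mem hz, Finset.mul_sum]
  · simp only [Set.indicator_of_notMem hz, Finset.sum_const_zero, mul_zero]

variable {Q : Matrix S S ℝ} {B : Set S}

lemma stepTime_le (hQ : IsQMatrix Q) (n : ℕ) (x y : S) :
    stepTime Q B n x y ≤ (exitRate Q y)⁻¹ := by
  classical
  induction n generalizing x with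
  | zero =>
    by_cases h : x = y <;> simp [stepTime, h]
  | succ n ih =>
    calc stepTime Q B (n + 1) x y
        ≤ (exitRate Q x)⁻¹ * ∑' z, rate Q x z * (exitRate Q y)⁻¹ := by
          rw [stepTime]
          gcongr with z
          refine (Set.indicator_le_self _ _ _).trans ?_
          gcongr
          exact ih z
      _ = ((exitRate Q x)⁻¹ * exitRate Q x) * (exitRate Q y)⁻¹ := by
          rw [ENNReal.tsum_mul_right, tsum_rate hQ, mul_assoc]
      _ ≤ 1 * (exitRate Q y)⁻¹ := by
          gcongr
          exact ENNReal.inv_mul_le_one _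
      _ = _ := one_mul _

/-- Maximum principle: from `x ≠ y` the time in `y` is at most an average, over the first jump, of
times with a smaller truncation. -/
lemma sum_stepTime_le (hQ : IsQMatrix Q) (n : ℕ) (x y : S) :
    ∑ k ∈ Finset.range n, stepTime Q B k x y ≤ ∑ k ∈ Finset.range n, stepTime Q B k y y := by
  classical
  induction n generalizing x with
  | zero => simp
  | succ n ih =>
    by_cases hxy : x = y
    · rw [hxy]
    rw [sum_stepTime_succ]
    calc stepTime Q B 0 x y + (exitRate Q x)⁻¹ *
          ∑' z, rate Q x z * Bᶜ.indicator (fun z => ∑ k ∈ Finset.range n, stepTime Q B k z y) z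
        ≤ 0 + (exitRate Q x)⁻¹ *
          ∑' z, rate Q x z * ∑ k ∈ Finset.range n, stepTime Q B k y y := by
          gcongr with z
          · simp [stepTime, hxy]
          · exact (Set.indicator_le_self _ _ _).trans (ih z)
      _ = ((exitRate Q x)⁻¹ * exitRate Q x) * ∑ k ∈ Finset.range n, stepTime Q B k y y := by
          rw [ENNReal.tsum_mul_right, tsum_rate hQ, mul_assoc, zero_add]
      _ ≤ 1 * ∑ k ∈ Finset.range n, stepTime Q B k y y := by
          gcongr
          exact ENNReal.inv_mul_le_one _
      _ ≤ _ := by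
          rw [one_mul]
          exact Finset.sum_le_sum_of_subset (by simp)

/-- Writing `u n` for the truncated time in `y` from `y`, this is `v n x ≤ C + (1 - ε) * u n`
without subtraction: a path from `x` into `B` loses a fixed fraction of `u n`. Going back one jump
along the path multiplies `ε` by the jump probability and adds one mean sojourn to `C`. Uniformity
in `n` is what matters. -/
lemma exists_sum_stepTime_add_le (hQ : IsQMatrix Q) (hq : ∀ x, Q x x < 0) {x b : S}
    (hb : b ∈ B) (hxb : Relation.ReflTransGen (fun u v => u ≠ v ∧ 0 < Q u v) x b) (y : S) :
    ∃ ε C : ℝ≥0∞, ε ≠ 0 ∧ C ≠ ∞ ∧ ∀ n,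
      Bᶜ.indicator (fun x => ∑ k ∈ Finset.range n, stepTime Q B k x y) x +
        ε * ∑ k ∈ Finset.range n, stepTime Q B k y y ≤
      C + ∑ k ∈ Finset.range n, stepTime Q B k y y := by
  classical
  induction hxb using Relation.ReflTransGen.head_induction_on with
  | refl =>
    exact ⟨1, 0, one_ne_zero, ENNReal.zero_ne_top, fun n => by simp [hb]⟩
  | @head x z hxz _ ih =>
    obtain ⟨ε, C, hε, hC, h⟩ := ih
    set q := exitRate Q x with hqdef
    have hq0 : q ≠ 0 := exitRate_ne_zero hq x
    have hqt : q ≠ ∞ := exitRate_ne_top Q x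
    have hρ : rate Q x z ≠ 0 := rate_ne_zero hxz
    have hρt : rate Q x z ≠ ∞ := by
      unfold rate; split_ifs <;> simp
    refine ⟨q⁻¹ * (rate Q x z * ε), q⁻¹ + q⁻¹ * (rate Q x z * C), ?_, ?_, fun n => ?_⟩
    · simp [hqt, hρ, hε]
    · simp [hq0, ENNReal.mul_eq_top, hρt, hC]
    set u := ∑ k ∈ Finset.range n, stepTime Q B k y y with hu
    set v : S → ℝ≥0∞ := Bᶜ.indicator fun z => ∑ k ∈ Finset.range n, stepTime Q B k z y with hv
    have hvu : ∀ w, v w ≤ u := fun w => (Set.indicator_le_self _ _ _).trans (sum_stepTime_le hQ n w y)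
    have hsplit : ∀ f : S → ℝ≥0∞, ∑' w, f w = f z + ∑' w, if w = z then 0 else f w := fun f =>
      ENNReal.tsum_eq_add_tsum_ite z
    have key : ∑' w, rate Q x w * v w + rate Q x z * ε * u ≤ rate Q x z * C + q * u := by
      rw [hqdef, ← tsum_rate hQ, ← ENNReal.tsum_mul_right, hsplit, hsplit (fun w => _ * u)]
      calc rate Q x z * v z + (∑' w, if w = z then 0 else rate Q x w * v w) + rate Q x z * ε * u
          = rate Q x z * (v z + ε * u) + ∑' w, if w = z then 0 else rate Q x w * v w := by ring
        _ ≤ rate Q x z * (C + u) + ∑' w, if w = z then 0 else rate Q x w * u := by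
            have h1 : v z + ε * u ≤ C + u := h n
            refine add_le_add (by gcongr) (ENNReal.tsum_le_tsum fun w => ?_)
            split_ifs
            · exact le_rfl
            · gcongr
              exact hvu w
        _ = _ := by ring
    calc v x + q⁻¹ * (rate Q x z * ε) * u
        ≤ (q⁻¹ + q⁻¹ * ∑' w, rate Q x w * v w) + q⁻¹ * (rate Q x z * ε) * u := by
          gcongr
          calc v x ≤ ∑ k ∈ Finset.range n, stepTime Q B k x y := Set.indicator_le_self _ _ _
            _ ≤ ∑ k ∈ Finset.range (n + 1), stepTime Q B k x y :=
              Finset.sum_le_sum_of_subset (by simp)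
            _ ≤ _ := by
              rw [sum_stepTime_succ]
              gcongr
              by_cases hxy : x = y <;> simp [stepTime, hxy, hqdef]
      _ = q⁻¹ + q⁻¹ * (∑' w, rate Q x w * v w + rate Q x z * ε * u) := by ring
      _ ≤ q⁻¹ + q⁻¹ * (rate Q x z * C + q * u) := by gcongr
      _ = q⁻¹ + q⁻¹ * (rate Q x z * C) + (q⁻¹ * q) * u := by ring
      _ = _ := by rw [ENNReal.inv_mul_cancel hq0 hqt, one_mul]

lemma occTime_le_self (hQ : IsQMatrix Q) (x y : S) : occTime Q B x y ≤ occTime Q B y y :=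
  ENNReal.tsum_le_of_sum_range_le fun n =>
    (sum_stepTime_le hQ n x y).trans (ENNReal.sum_le_tsum _)

/-- Times spent before entering a nonempty set are finite for an irreducible process. -/
lemma occTime_ne_top (hQ : IsQMatrix Q) (hq : ∀ x, Q x x < 0) (hirr : IsIrreducible Q)
    (hB : B.Nonempty) (x y : S) : occTime Q B x y ≠ ∞ := by
  classical
  by_cases hy : y ∈ B
  · rw [occTime_of_mem hy]
    exact ne_top_of_le_ne_top (by simpa using exitRate_ne_zero hq y) (stepTime_le hQ 0 x y)
  obtain ⟨b, hb⟩ := hB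
  obtain ⟨ε, C, hε, hC, h⟩ := exists_sum_stepTime_add_le hQ hq hb (hirr y b) y
  refine ne_top_of_le_ne_top (ENNReal.div_ne_top hC hε)
    ((occTime_le_self hQ x y).trans (ENNReal.tsum_le_of_sum_range_le fun n => ?_))
  have hfin : ∑ k ∈ Finset.range n, stepTime Q B k y y ≠ ∞ := by
    refine ENNReal.sum_ne_top.mpr fun k _ => ?_
    exact ne_top_of_le_ne_top (by simpa using exitRate_ne_zero hq y) (stepTime_le hQ k y y)
  -- At the starting point `y` the finite truncated time appears on both sides; cancelling it bounds
  -- `ε` times that time by `C`, uniformly in `n`.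
  have h1 := h n
  rw [Set.indicator_of_mem (by simpa using hy), add_comm] at h1
  have h2 := (ENNReal.add_le_add_iff_right hfin).mp h1
  rw [ENNReal.le_div_iff_mul_le (Or.inl hε) (Or.inr hC), mul_comm]
  exact h2

lemma inv_exitRate_le_occTime (x : S) : (exitRate Q x)⁻¹ ≤ occTime Q B x x := by
  classical
  refine le_trans ?_ (ENNReal.le_tsum 0)
  simp [stepTime]

/-- The sum is the probability of ever jumping into `a`. -/
lemma tsum_occTime_mul_rate_le_one (hQ : IsQMatrix Q) (a x : S) :
    ∑' z, occTime Q {a} x z * rate Q z a ≤ 1 := by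
  classical
  simp only [occTime, ← ENNReal.tsum_mul_right]
  rw [ENNReal.tsum_comm]
  refine ENNReal.tsum_le_of_sum_range_le fun n => ?_
  rw [← Summable.tsum_finsetSum fun _ _ => ENNReal.summable]
  simp only [← Finset.sum_mul]
  induction n generalizing x with
  | zero => simp
  | succ n ih =>
    simp only [sum_stepTime_succ, add_mul]
    rw [ENNReal.tsum_add]
    have h1 : ∑' z, stepTime Q {a} 0 x z * rate Q z a = (exitRate Q x)⁻¹ * rate Q x a := by
      rw [tsum_eq_single x]
      · simp [stepTime]
      · intro z hz
        simp [stepTime, hz.symm]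
    have h2 : ∑' z, (exitRate Q x)⁻¹ * (∑' w, rate Q x w *
        ({a}ᶜ : Set S).indicator (fun w => ∑ k ∈ Finset.range n, stepTime Q {a} k w z) w) *
          rate Q z a ≤ (exitRate Q x)⁻¹ * ∑' w, if w = a then 0 else rate Q x w := by
      simp only [mul_assoc, ENNReal.tsum_mul_left, ← ENNReal.tsum_mul_right]
      rw [ENNReal.tsum_comm]
      gcongr with w
      rw [ENNReal.tsum_mul_left]
      split_ifs with hw
      · simp [hw]
      · have hw' : w ∈ ({a}ᶜ : Set S) := hw
        simp only [Set.indicator_of_mem hw']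
        exact mul_le_of_le_one_right' (ih w)
    rw [h1]
    calc _ ≤ (exitRate Q x)⁻¹ * rate Q x a +
          (exitRate Q x)⁻¹ * ∑' w, (if w = a then 0 else rate Q x w) := by gcongr
      _ = (exitRate Q x)⁻¹ * exitRate Q x := by
          rw [← mul_add, ← tsum_rate hQ, ENNReal.tsum_eq_add_tsum_ite a]
      _ ≤ 1 := ENNReal.inv_mul_le_one _

/-- The time spent in the states during an excursion from `a` is a subinvariant measure. -/
lemma tsum_occTime_mul_rate_le (hQ : IsQMatrix Q) (hq : ∀ x, Q x x < 0) (a y : S) :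
    ∑' z, occTime Q {a} a z * rate Q z y ≤ occTime Q {a} a y * exitRate Q y := by
  classical
  by_cases hy : y = a
  -- At `a` the inflow is a return probability, while the initial sojourn alone makes the outflow at
  -- least `1`.
  · subst hy
    refine (tsum_occTime_mul_rate_le_one hQ y y).trans ?_
    rw [← ENNReal.inv_mul_cancel (exitRate_ne_zero hq y) (exitRate_ne_top Q y)]
    gcongr
    exact inv_exitRate_le_occTime y
  · rw [occTime_mul_exitRate hq (by simpa using hy)]
    exact le_add_self

end Bounds

/-! ### Subinvariant measures and uniqueness of the stationary distribution -/

section Stationary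

variable {S : Type*} {Q : Matrix S S ℝ}

lemma minTrans_eq_tsum_jumpProb {t : ℝ} (ht : 0 < t) (x y : S) :
    minTrans Q t x y = ∑' n, jumpProb Q n x y t := by
  simp [minTrans, jumpProb, ht]

open Classical in
lemma minTrans_zero (x y : S) : minTrans Q 0 x y = if x = y then 1 else 0 := by
  rw [minTrans, tsum_eq_single 0]
  · simp [nJump]
  · intro n hn
    obtain ⟨k, rfl⟩ := Nat.exists_eq_succ_of_ne_zero hn
    simp [nJump]

lemma eq_of_le_of_tsum_eq {f g : S → ℝ≥0∞} (hle : ∀ x, f x ≤ g x) (hs : ∑' x, f x = ∑' x, g x)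
    (hf : ∑' x, f x ≠ ∞) (x : S) : f x = g x := by
  by_contra h
  exact (ENNReal.tsum_lt_tsum hf hle (lt_of_le_of_ne (hle x) h)).ne hs

lemma tsum_tsum_mul_minTrans (hne : IsNonExplosive Q) (m : S → ℝ≥0∞) {t : ℝ} (ht : 0 ≤ t) :
    ∑' y, ∑' x, m x * minTrans Q t x y = ∑' x, m x := by
  rw [ENNReal.tsum_comm]
  refine tsum_congr fun x => ?_
  rw [ENNReal.tsum_mul_left, hne t ht x, mul_one]

variable [Countable S]

/-- Induction through the last jump: mass that jumped into `y` is at most `m y` times the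
probability that the holding time has ended by `t`, and mass that never moved is `m y` times the
probability that it has not. -/
lemma tsum_mul_sum_jumpProb_le (hq : ∀ x, Q x x < 0) {m : S → ℝ≥0∞}
    (hm : ∀ y, ∑' z, m z * rate Q z y ≤ m y * exitRate Q y) (n : ℕ) {t : ℝ} (ht : 0 < t) (y : S) :
    ∑' x, m x * ∑ k ∈ Finset.range n, jumpProb Q k x y t ≤ m y := by
  classical
  induction n generalizing t y with
  | zero => simp
  | succ n ih =>
    have hE := measurable_holding Q
    have hN := measurable_jumpProb Q
    have h0 : ∑' x, m x * jumpProb Q 0 x y t = m y * holding Q y t := by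
      rw [tsum_eq_single y]
      · simp [jumpProb_zero]
      · intro z hz
        simp [jumpProb_zero, hz]
    have h1 : ∀ z, ∑' x, m x * ∑ k ∈ Finset.range n, (jumpProb Q k x z ⋆ₗ holding Q y) t ≤
        m z * ∫⁻ s in Set.Iic t, holding Q y s := by
      intro z
      have h2 : ∀ x, ∑ k ∈ Finset.range n, (jumpProb Q k x z ⋆ₗ holding Q y) t =
          ((fun s => ∑ k ∈ Finset.range n, jumpProb Q k x z s) ⋆ₗ holding Q y) t := by
        intro x
        simp only [lconvolution_def, Finset.sum_mul]
        rw [lintegral_finsetSum]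
        intro k _
        have := hN k x z
        have := hE y
        fun_prop
      simp only [h2]
      have h3 := congrFun (tsum_lconvolution (fun x s => ∑ k ∈ Finset.range n, jumpProb Q k x z s)
        (holding Q y) m (fun x => Finset.measurable_fun_sum _ fun k _ => hN k x z) (hE y)) t
      rw [← h3, lconvolution_comm, lconvolution_def, ← lintegral_const_mul _ (hE y),
        ← lintegral_indicator measurableSet_Iic]
      refine lintegral_mono fun s => ?_
      by_cases hs : s < t
      · rw [Set.indicator_of_mem (show s ∈ Set.Iic t from hs.le), mul_comm]
        gcongr
        exact ih (by linarith) z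
      · have : ¬ (0 < -s + t) := by linarith
        simp [jumpProb, this]
    have h4 : ∑' x, m x * ∑ k ∈ Finset.range n, jumpProb Q (k + 1) x y t ≤
        (m y * exitRate Q y) * ∫⁻ s in Set.Iic t, holding Q y s := by
      calc ∑' x, m x * ∑ k ∈ Finset.range n, jumpProb Q (k + 1) x y t
          = ∑' z, rate Q z y * ∑' x, m x *
              ∑ k ∈ Finset.range n, (jumpProb Q k x z ⋆ₗ holding Q y) t := by
            simp only [jumpProb_succ', ← ENNReal.tsum_mul_left]
            rw [ENNReal.tsum_comm]
            refine tsum_congr fun x => ?_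
            rw [← Summable.tsum_finsetSum fun _ _ => ENNReal.summable, ← ENNReal.tsum_mul_left]
            refine tsum_congr fun z => ?_
            rw [← Finset.mul_sum]
            ring
        _ ≤ ∑' z, rate Q z y * (m z * ∫⁻ s in Set.Iic t, holding Q y s) := by
            gcongr with z
            exact h1 z
        _ = (∑' z, m z * rate Q z y) * ∫⁻ s in Set.Iic t, holding Q y s := by
            rw [← ENNReal.tsum_mul_right]
            exact tsum_congr fun z => by ring
        _ ≤ _ := by
            gcongr
            exact hm y
    simp only [Finset.sum_range_succ', mul_add]
    rw [ENNReal.tsum_add, h0]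
    calc _ ≤ (m y * exitRate Q y) * (∫⁻ s in Set.Iic t, holding Q y s) + m y * holding Q y t := by
          gcongr
      _ = m y * (holding Q y t + exitRate Q y * ∫⁻ s in Set.Iic t, holding Q y s) := by ring
      _ = m y := by rw [holding_add_lintegral_holding (hq y) ht, mul_one]

/-- A measure which is subinvariant for the `q`-matrix is subinvariant for its minimal
transition function. -/
lemma tsum_mul_minTrans_le (hq : ∀ x, Q x x < 0) {m : S → ℝ≥0∞}
    (hm : ∀ y, ∑' z, m z * rate Q z y ≤ m y * exitRate Q y) {t : ℝ} (ht : 0 ≤ t) (y : S) :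
    ∑' x, m x * minTrans Q t x y ≤ m y := by
  classical
  rcases ht.eq_or_lt with rfl | ht
  · rw [tsum_eq_single y]
    · simp [minTrans_zero]
    · intro z hz
      simp [minTrans_zero, hz]
  · simp only [minTrans_eq_tsum_jumpProb ht, ← ENNReal.tsum_mul_left]
    rw [ENNReal.tsum_comm]
    refine ENNReal.tsum_le_of_sum_range_le fun n => ?_
    rw [← Summable.tsum_finsetSum fun _ _ => ENNReal.summable]
    simp only [← Finset.mul_sum]
    exact tsum_mul_sum_jumpProb_le hq hm n ht y

/-- Honesty makes both sides of the subinvariance inequality have the same finite mass, so they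
agree termwise. -/
lemma isStationary_of_subinvariant (hq : ∀ x, Q x x < 0) (hne : IsNonExplosive Q)
    {m : S → ℝ≥0∞} (hm : ∀ y, ∑' z, m z * rate Q z y ≤ m y * exitRate Q y)
    (hsum : ∑' x, m x = 1) : IsStationary Q fun x => (m x).toReal := by
  have hfin : ∀ x, m x ≠ ∞ := ENNReal.ne_top_of_tsum_ne_top (by simp [hsum])
  refine ⟨fun x => ENNReal.toReal_nonneg, ?_, fun t ht y => ?_⟩
  · have := ENNReal.hasSum_toReal (f := m) (by simp [hsum])
    rwa [← ENNReal.tsum_toReal_eq hfin, hsum, ENNReal.toReal_one] at this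
  · simp only [ENNReal.ofReal_toReal (hfin _)]
    have h := tsum_tsum_mul_minTrans hne m ht
    exact eq_of_le_of_tsum_eq (fun y => tsum_mul_minTrans_le hq hm ht y) h
      (by simp [h, hsum]) y

/-- The jump count `n` comes from a path and is fixed before `t`, as the induction uses the shorter
path at all remaining times. -/
lemma minTrans_pos (hirr : IsIrreducible Q) (x y : S) {t : ℝ} (ht : 0 < t) :
    minTrans Q t x y ≠ 0 := by
  classical
  suffices h : ∃ n, ∀ t, 0 < t → jumpProb Q n x y t ≠ 0 by
    obtain ⟨n, hn⟩ := h
    rw [minTrans_eq_tsum_jumpProb ht]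
    exact fun h0 => hn t ht (ENNReal.tsum_eq_zero.mp h0 n)
  induction hirr x y using Relation.ReflTransGen.head_induction_on with
  | refl =>
    refine ⟨0, fun t ht => ?_⟩
    simp [jumpProb_zero, holding, ht, Real.exp_pos]
  | @head x z hxz _ ih =>
    obtain ⟨n, hn⟩ := ih
    refine ⟨n + 1, fun t ht => ?_⟩
    rw [jumpProb_succ]
    intro h0
    have h1 := (ENNReal.tsum_eq_zero.mp h0) z
    rcases mul_eq_zero.mp h1 with h2 | h2
    · exact rate_ne_zero hxz h2
    · rw [lconvolution_def, ← not_ne_iff, ← pos_iff_ne_zero, lintegral_pos_iff_support] at h2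
      · refine h2 (lt_of_lt_of_le ?_ (measure_mono (s := Set.Ioo 0 t) fun s hs => ?_))
        · simpa using ht
        · refine mul_ne_zero ?_ (hn _ (by linarith [hs.2]))
          simp [holding, hs.1, Real.exp_pos]
      · have := measurable_holding Q x
        have := measurable_jumpProb Q n z y
        fun_prop

/-- An irreducible non-explosive process has at most one stationary distribution. -/
lemma IsStationary.unique (hirr : IsIrreducible Q) (hne : IsNonExplosive Q) {p p' : S → ℝ}
    (hp : IsStationary Q p) (hp' : IsStationary Q p') : p = p' := by
  have hsum : ∀ {p : S → ℝ}, IsStationary Q p → ∑' x, ENNReal.ofReal (p x) = 1 := by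
    intro p hp
    rw [← ENNReal.ofReal_tsum_of_nonneg hp.nonneg hp.hasSum_one.summable, hp.hasSum_one.tsum_eq,
      ENNReal.ofReal_one]
  set f : S → ℝ≥0∞ := fun x => ENNReal.ofReal (p x)
  set g : S → ℝ≥0∞ := fun x => ENNReal.ofReal (p' x)
  have hf1 : ∑' x, f x = 1 := hsum hp
  have hg1 : ∑' x, g x = 1 := hsum hp'
  have hfM : ∀ y, ∑' x, f x * minTrans Q 1 x y = f y := hp.invariant 1 zero_le_one
  have hgM : ∀ y, ∑' x, g x * minTrans Q 1 x y = g y := hp'.invariant 1 zero_le_one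
  -- The minimum is subinvariant, hence invariant by conservation of mass.
  set m : S → ℝ≥0∞ := fun x => min (f x) (g x) with hmdef
  have hmf : ∀ x, m x ≤ f x := fun x => min_le_left _ _
  have hmg : ∀ x, m x ≤ g x := fun x => min_le_right _ _
  have hmtop : ∀ x, m x ≠ ∞ := fun x => ne_top_of_le_ne_top ENNReal.ofReal_ne_top (hmf x)
  have hmM : ∀ y, ∑' x, m x * minTrans Q 1 x y = m y := by
    have h := tsum_tsum_mul_minTrans hne m zero_le_one
    refine eq_of_le_of_tsum_eq (fun y => le_min ?_ ?_) h ?_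
    · rw [← hfM y]
      gcongr with x
      exact hmf x
    · rw [← hgM y]
      gcongr with x
      exact hmg x
    · rw [h]
      exact ne_top_of_le_ne_top (by simp [hf1]) (ENNReal.tsum_le_tsum hmf)
  -- `F - m` is invariant, so if it is nonzero somewhere, irreducibility makes it positive
  -- everywhere. This cannot happen for both `f` and `g`.
  have hpos : ∀ F : S → ℝ≥0∞, (∀ y, ∑' x, F x * minTrans Q 1 x y = F y) → (∀ x, m x ≤ F x) →
      ∀ x, m x ≠ F x → ∀ y, m y < F y := by
    intro F hF hmF x hx y
    have hd : ∀ y, ∑' x, (F x - m x) * minTrans Q 1 x y = F y - m y := by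
      intro y
      have h1 : F y = m y + ∑' x, (F x - m x) * minTrans Q 1 x y := by
        rw [← hF y, ← hmM y, ← ENNReal.tsum_add]
        refine tsum_congr fun x => ?_
        rw [← add_mul, add_tsub_cancel_of_le (hmF x)]
      rw [h1, ENNReal.add_sub_cancel_left (hmtop y)]
    rw [← tsub_pos_iff_lt, ← hd y, pos_iff_ne_zero]
    intro h0
    have h1 := ENNReal.tsum_eq_zero.mp h0 x
    rcases mul_eq_zero.mp h1 with h2 | h2
    · exact hx (le_antisymm (hmF x) (tsub_eq_zero_iff_le.mp h2))
    · exact minTrans_pos hirr x y one_pos h2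
  have hfg : ∀ x, f x = g x := by
    by_cases hA : ∀ x, m x = f x
    · exact eq_of_le_of_tsum_eq (fun x => hA x ▸ hmg x) (hf1.trans hg1.symm) (by simp [hf1])
    by_cases hB : ∀ x, m x = g x
    · exact fun x => (eq_of_le_of_tsum_eq (fun x => hB x ▸ hmf x) (hg1.trans hf1.symm)
        (by simp [hg1]) x).symm
    push Not at hA hB
    obtain ⟨x, hx⟩ := hA
    obtain ⟨y, hy⟩ := hB
    have h1 := hpos f hfM hmf x hx x
    have h2 := hpos g hgM hmg y hy x
    exact absurd (lt_min h1 h2) (lt_irrefl _)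
  ext x
  exact (ENNReal.ofReal_eq_ofReal_iff (hp.nonneg x) (hp'.nonneg x)).mp (hfg x)

end Stationary

/-! ### Shift invariance and skip-freeness across levels -/

section Homogeneity

variable {ι : Type*}

/-- The states whose level is at least `-n`. -/
def upperLevels (ι : Type*) (n : ℕ) : Set (ℕ × ι) := {x | x.1 ≤ n}

lemma topLevel_eq_upperLevels : topLevel ι = upperLevels ι 0 := by
  ext x
  simp [topLevel, upperLevels]

lemma tsum_indicator_upperLevels_compl (n : ℕ) (f : ℕ × ι → ℝ≥0∞) :
    ∑' z, (upperLevels ι n)ᶜ.indicator f z = ∑' z : ℕ × ι, f (z.1 + 1 + n, z.2) := by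
  have hinj : Function.Injective fun z : ℕ × ι => (z.1 + 1 + n, z.2) := by
    rintro ⟨a, b⟩ ⟨c, d⟩ h
    simpa using h
  rw [← hinj.tsum_eq]
  · refine tsum_congr fun z => Set.indicator_of_mem ?_ _
    simp only [upperLevels, Set.mem_compl_iff, Set.mem_ofPred_eq]
    omega
  · intro z hz
    have h : z ∈ (upperLevels ι n)ᶜ := Set.mem_of_indicator_ne_zero hz
    simp only [upperLevels, Set.mem_compl_iff, Set.mem_ofPred_eq, not_le] at h
    exact ⟨(z.1 - 1 - n, z.2), Prod.ext (by simp only; omega) rfl⟩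

variable (D W W' : Matrix ι ι ℝ) (U U' : ℕ → Matrix ι ι ℝ)

/-- The `+ 1` keeps both states off level `0`, where the rates differ; the `+ 0` makes the right
side literally the instance `n = 0` of the left. -/
lemma generator_shift (n k l : ℕ) (i j : ι) :
    generator D W W' U U' (k + 1 + n, i) (l + 1 + n, j) =
      generator D W W' U U' (k + 1 + 0, i) (l + 1 + 0, j) := by
  have h1 : k + 1 + n - (l + 1 + n) = k - l := by omega
  have h2 : k + 1 + n + 1 < l + 1 + n ↔ k + 1 < l := by omega
  have h3 : l + 1 + n = k + 1 + n + 1 ↔ l = k + 1 := by omega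
  simp [generator, h1, h2, h3]

lemma rate_shift (n k l : ℕ) (i j : ι) :
    rate (generator D W W' U U') (k + 1 + n, i) (l + 1 + n, j) =
      rate (generator D W W' U U') (k + 1 + 0, i) (l + 1 + 0, j) := by
  classical
  simp only [rate, generator_shift D W W' U U' n]
  simp

lemma exitRate_shift (n k : ℕ) (i : ι) :
    exitRate (generator D W W' U U') (k + 1 + n, i) =
      exitRate (generator D W W' U U') (k + 1 + 0, i) := by
  simp only [exitRate, generator_shift D W W' U U' n]

lemma stepTime_shift (n N k l : ℕ) (i j : ι) :
    stepTime (generator D W W' U U') (upperLevels ι n) N (k + 1 + n, i) (l + 1 + n, j) =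
      stepTime (generator D W W' U U') (upperLevels ι 0) N (k + 1 + 0, i) (l + 1 + 0, j) := by
  classical
  induction N generalizing k i with
  | zero =>
    simp only [stepTime, exitRate_shift D W W' U U' n]
    simp
  | succ N ih =>
    simp only [stepTime, exitRate_shift D W W' U U' n, tsum_indicator_upperLevels_compl,
      rate_shift D W W' U U' n, ih]

/-- Homogeneity: the times spent below level `-n` before returning to the levels `≥ -n` do not
depend on `n`. -/
lemma occTime_shift (n k l : ℕ) (i j : ι) :
    occTime (generator D W W' U U') (upperLevels ι n) (k + 1 + n, i) (l + 1 + n, j) =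
      occTime (generator D W W' U U') (upperLevels ι 0) (k + 1, i) (l + 1, j) :=
  tsum_congr fun N => stepTime_shift D W W' U U' n N k l i j

lemma rate_of_level_le {n : ℕ} {u k : ℕ × ι} (hu : u.1 ≤ n) (hk : n < k.1) :
    rate (generator D W W' U U') u k =
      if u.1 = n ∧ k.1 = n + 1 then ENNReal.ofReal (D u.2 k.2) else 0 := by
  classical
  have hne : k ≠ u := fun h => by rw [h] at hk; omega
  rw [rate, if_neg hne]
  by_cases h : u.1 = n ∧ k.1 = n + 1
  · rw [if_pos h]
    simp [generator, h.1, h.2]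
  · rw [if_neg h]
    have h1 : u.1 + 1 < k.1 := by omega
    simp [generator, h1]

lemma levelTime_eq_occTime [Countable ι] {Q : Matrix (ℕ × ι) (ℕ × ι) ℝ} (hq : ∀ x, Q x x < 0)
    (i j : ι) : levelTime Q i j = occTime Q (upperLevels ι 0) (1, i) (1, j) := by
  rw [levelTime, tabooTime_eq_occTime hq, ← topLevel_eq_upperLevels]
  rfl

variable {D}

/-- During an excursion from a state of level at least `-n`, the time spent in level `-(n + 1)`
is proportional to `t̂`. -/
lemma occTime_next_level [Countable ι] {Q : Matrix (ℕ × ι) (ℕ × ι) ℝ}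
    (hQ : Q = generator D W W' U U') (hq : ∀ x, Q x x < 0) {cE rE : ι → ℝ≥0∞}
    (hD : ∀ i j, ENNReal.ofReal (D i j) = cE i * rE j) {a : ℕ × ι} {n : ℕ} (ha : a.1 ≤ n) (j : ι) :
    occTime Q {a} a (n + 1, j) =
      (∑' i, occTime Q {a} a (n, i) * cE i) * ∑' k, rE k * levelTime Q k j := by
  have haA : a ∈ upperLevels ι n := ha
  rw [occTime_last_exit (Set.singleton_subset_iff.mpr haA) haA (by simp [upperLevels])]
  -- The rate of exits into `k` is a scalar flow times `rE`: this is where the product form of `D`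
  -- enters.
  have h1 : ∀ k : ↥(upperLevels ι n)ᶜ, (∑' u : upperLevels ι n, occTime Q {a} a u * rate Q u k) =
      if k.1.1 = n + 1 then (∑' i, occTime Q {a} a (n, i) * cE i) * rE k.1.2 else 0 := by
    intro k
    have hk : n < k.1.1 := not_le.mp k.2
    have h2 : ∀ u : upperLevels ι n, occTime Q {a} a u * rate Q u k =
        (fun u : ℕ × ι => if u.1 = n then (if k.1.1 = n + 1 then
          occTime Q {a} a u * (cE u.2 * rE k.1.2) else 0) else 0) u := by
      intro u
      rw [hQ, rate_of_level_le D W W' U U' u.2 hk, hD]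
      by_cases hu : u.1.1 = n <;> by_cases hk' : k.1.1 = n + 1 <;> simp [hu, hk']
    rw [tsum_congr h2, tsum_subtype_eq_of_support_subset (s := upperLevels ι n)
      (f := fun u : ℕ × ι => if u.1 = n then (if k.1.1 = n + 1 then
          occTime Q {a} a u * (cE u.2 * rE k.1.2) else 0) else 0), ENNReal.tsum_prod',
      tsum_eq_single n]
    · by_cases hk' : k.1.1 = n + 1
      · simp only [if_true, if_pos hk', ← ENNReal.tsum_mul_right]
        exact tsum_congr fun i => by ring
      · simp [hk']
    · intro m hm
      simp [hm]
    · intro u hu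
      by_contra h
      have : u.1 ≠ n := fun h' => h (le_of_eq h')
      simp [this] at hu
  simp only [h1]
  rw [tsum_subtype (upperLevels ι n)ᶜ (fun k : ℕ × ι => (if k.1 = n + 1 then
    (∑' i, occTime Q {a} a (n, i) * cE i) * rE k.2 else 0) *
      occTime Q (upperLevels ι n) k (n + 1, j)), tsum_indicator_upperLevels_compl,
    ENNReal.tsum_prod', tsum_eq_single 0]
  · rw [← ENNReal.tsum_mul_left]
    refine tsum_congr fun k => ?_
    rw [levelTime_eq_occTime hq, hQ, if_pos (by omega), mul_assoc]
    congr 2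
    have h := occTime_shift D W W' U U' n 0 0 k j
    simp only [zero_add] at h
    rw [← h, zero_add, add_comm 1 n]
  · intro m hm
    have : ¬ (m + 1 + n = n + 1) := by omega
    simp [this]

end Homogeneity

/-! ### Geometric decay over the levels -/

section ProductForm

variable {ι : Type*} {D W W' : Matrix ι ι ℝ} {U U' : ℕ → Matrix ι ι ℝ} {c r : ι → ℝ}
  {Q : Matrix (ℕ × ι) (ℕ × ι) ℝ}

lemma vecMulVec_nonneg (hQ : Q = generator D W W' U U') (hD : D = Matrix.vecMulVec c r)
    (hcons : IsQMatrix Q) (i k : ι) : 0 ≤ c i * r k := by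
  have h := hcons.nonneg (0, i) (1, k) (by simp)
  simpa [hQ, generator, hD, Matrix.vecMulVec_apply] using h

/-- Otherwise level `0` could not be left. -/
lemma exists_vecMulVec_pos [Nonempty ι] (hQ : Q = generator D W W' U U')
    (hD : D = Matrix.vecMulVec c r) (hcons : IsQMatrix Q) (hirr : IsIrreducible Q) :
    ∃ i k, 0 < c i * r k := by
  by_contra! hno
  have h0 : ∀ i k, c i * r k = 0 := fun i k =>
    le_antisymm (hno i k) (vecMulVec_nonneg hQ hD hcons i k)
  obtain ⟨i⟩ := ‹Nonempty ι›
  have h : ∀ y : ℕ × ι, Relation.ReflTransGen (fun u v => u ≠ v ∧ 0 < Q u v) (0, i) y →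
      y.1 = 0 := by
    intro y hy
    induction hy with
    | refl => rfl
    | @tail u v _ huv ih =>
      by_contra hv
      have h1 := huv.2
      rcases Nat.lt_or_ge 1 v.1 with h2 | h2
      · simp [hQ, generator, ih, h2] at h1
      · have h3 : v.1 = 1 := by omega
        simp [hQ, generator, ih, h3, hD, Matrix.vecMulVec_apply, h0] at h1
  simpa using h (1, i) (hirr _ _)

/-- The vectors `c` and `r` have a common sign. -/
lemma exists_sign [Nonempty ι] (hQ : Q = generator D W W' U U')
    (hD : D = Matrix.vecMulVec c r) (hcons : IsQMatrix Q) (hirr : IsIrreducible Q) :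
    ∃ σ : ℝ, σ * σ = 1 ∧ (∀ i, c i = σ * |c i|) ∧ ∀ k, r k = σ * |r k| := by
  obtain ⟨i, k, hik⟩ := exists_vecMulVec_pos hQ hD hcons hirr
  have h := vecMulVec_nonneg hQ hD hcons
  -- The positive entry fixes the sign; nonnegativity of its row and column carries it to all of `r`
  -- and `c`.
  rcases pos_and_pos_or_neg_and_neg_of_mul_pos hik with ⟨hc, hr⟩ | ⟨hc, hr⟩
  · refine ⟨1, by norm_num, fun j => ?_, fun j => ?_⟩
    · rw [one_mul, abs_of_nonneg (nonneg_of_mul_nonneg_left (h j k) hr)]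
    · rw [one_mul, abs_of_nonneg (nonneg_of_mul_nonneg_right (h i j) hc)]
  · refine ⟨-1, by norm_num, fun j => ?_, fun j => ?_⟩
    · have : c j ≤ 0 := by nlinarith [h j k]
      rw [abs_of_nonpos this]
      ring
    · have : r j ≤ 0 := by nlinarith [h i j]
      rw [abs_of_nonpos this]
      ring

/-- The absolute values of `t̂`, as extended nonnegative reals. -/
noncomputable def absTHat (Q : Matrix (ℕ × ι) (ℕ × ι) ℝ) (r : ι → ℝ) (j : ι) : ℝ≥0∞ :=
  ∑' k, ENNReal.ofReal |r k| * levelTime Q k j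

/-- The number `γ`, as an extended nonnegative real. -/
noncomputable def absGamma (Q : Matrix (ℕ × ι) (ℕ × ι) ℝ) (c r : ι → ℝ) : ℝ≥0∞ :=
  ∑' j, absTHat Q r j * ENNReal.ofReal |c j|

/-- The intensity of the jumps from level `-n` to level `-(n + 1)` during an excursion
from `a`. -/
noncomputable def downFlow (Q : Matrix (ℕ × ι) (ℕ × ι) ℝ) (c : ι → ℝ) (a : ℕ × ι) (n : ℕ) : ℝ≥0∞ :=
  ∑' i, occTime Q {a} a (n, i) * ENNReal.ofReal |c i|

lemma hasSum_toReal_mul {α : Type*} {σ : ℝ} {f : α → ℝ≥0∞} (hf : ∑' i, f i ≠ ∞) :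
    HasSum (fun i => σ * (f i).toReal) (σ * (∑' i, f i).toReal) := by
  rw [ENNReal.tsum_toReal_eq (ENNReal.ne_top_of_tsum_ne_top hf)]
  exact (ENNReal.summable_toReal hf).hasSum.mul_left σ

lemma mul_T_eq {σ : ℝ} (hr : ∀ k, r k = σ * |r k|) (i j : ι) :
    r i * T Q i j = σ * (ENNReal.ofReal |r i| * levelTime Q i j).toReal := by
  rw [ENNReal.toReal_mul, ENNReal.toReal_ofReal (abs_nonneg _), T, ← mul_assoc, ← hr i]

lemma tHat_eq {σ : ℝ} (hr : ∀ k, r k = σ * |r k|) {j : ι} (hj : absTHat Q r j ≠ ∞) :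
    tHat Q r j = σ * (absTHat Q r j).toReal := by
  rw [tHat, tsum_congr fun i => mul_T_eq hr i j]
  exact (hasSum_toReal_mul hj).tsum_eq

lemma tHat_mul_eq {σ : ℝ} (hσ : σ * σ = 1) (hc : ∀ k, c k = σ * |c k|)
    (hr : ∀ k, r k = σ * |r k|) {j : ι} (hj : absTHat Q r j ≠ ∞) :
    tHat Q r j * c j = (absTHat Q r j * ENNReal.ofReal |c j|).toReal := by
  rw [tHat_eq hr hj, ENNReal.toReal_mul, ENNReal.toReal_ofReal (abs_nonneg _)]
  conv_lhs => rw [hc j]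
  linear_combination (absTHat Q r j).toReal * |c j| * hσ

/-- This also covers a divergent series: both sides then take the default value `0`. -/
lemma gamma_eq {σ : ℝ} (hσ : σ * σ = 1) (hc : ∀ k, c k = σ * |c k|)
    (hr : ∀ k, r k = σ * |r k|) (ht : ∀ j, absTHat Q r j ≠ ∞) :
    gamma Q c r = (absGamma Q c r).toReal := by
  rw [gamma, tsum_congr fun j => tHat_mul_eq hσ hc hr (ht j), absGamma,
    ENNReal.tsum_toReal_eq fun j => ENNReal.mul_ne_top (ht j) ENNReal.ofReal_ne_top]

variable [Countable ι]

lemma occTime_next_level_eq (hQ : Q = generator D W W' U U') (hD : D = Matrix.vecMulVec c r)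
    (hcons : IsQMatrix Q) (hq : ∀ x, Q x x < 0) {a : ℕ × ι} {n : ℕ} (ha : a.1 ≤ n) (j : ι) :
    occTime Q {a} a (n + 1, j) = downFlow Q c a n * absTHat Q r j := by
  refine occTime_next_level W W' U U' hQ hq (fun i k => ?_) ha j
  rw [← ENNReal.ofReal_mul (abs_nonneg _), ← abs_mul,
    abs_of_nonneg (vecMulVec_nonneg hQ hD hcons i k), hD, Matrix.vecMulVec_apply]

lemma downFlow_add (hQ : Q = generator D W W' U U') (hD : D = Matrix.vecMulVec c r)
    (hcons : IsQMatrix Q) (hq : ∀ x, Q x x < 0) {a : ℕ × ι} {n : ℕ} (ha : a.1 ≤ n) (k : ℕ) :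
    downFlow Q c a (n + k) = downFlow Q c a n * absGamma Q c r ^ k := by
  induction k with
  | zero => simp
  | succ k ih =>
    rw [pow_succ, ← mul_assoc, ← ih, ← add_assoc, downFlow]
    simp only [occTime_next_level_eq hQ hD hcons hq (ha.trans (Nat.le_add_right n k))]
    rw [absGamma, ← ENNReal.tsum_mul_left]
    exact tsum_congr fun j => mul_assoc _ _ _

/-- Starting where `c` is nonzero makes the flow nonzero, because the initial sojourn contributes.
Such nonzero factors let finiteness of a product pass to the other factor. -/
lemma exists_base_phase [Nonempty ι] (hQ : Q = generator D W W' U U')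
    (hD : D = Matrix.vecMulVec c r) (hcons : IsQMatrix Q) (hirr : IsIrreducible Q)
    (hq : ∀ x, Q x x < 0) : ∃ i k, downFlow Q c (0, i) 0 ≠ 0 ∧ absTHat Q r k ≠ 0 := by
  obtain ⟨i, k, hik⟩ := exists_vecMulVec_pos hQ hD hcons hirr
  have hc : c i ≠ 0 := left_ne_zero_of_mul hik.ne'
  have hr : r k ≠ 0 := right_ne_zero_of_mul hik.ne'
  have hocc : ∀ (B : Set (ℕ × ι)) (x : ℕ × ι), occTime Q B x x ≠ 0 := fun B x h =>
    ENNReal.inv_ne_zero.mpr (exitRate_ne_top Q x)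
      (le_antisymm ((inv_exitRate_le_occTime x).trans h.le) zero_le)
  refine ⟨i, k, fun h => ?_, fun h => ?_⟩
  · have := ENNReal.tsum_eq_zero.mp h i
    simp [hc, hocc] at this
  · have := ENNReal.tsum_eq_zero.mp h k
    simp [hr, levelTime_eq_occTime hq, hocc] at this

lemma levelTime_ne_top [Nonempty ι] (hcons : IsQMatrix Q) (hirr : IsIrreducible Q)
    (hq : ∀ x, Q x x < 0) (i j : ι) : levelTime Q i j ≠ ∞ := by
  rw [levelTime_eq_occTime hq]
  obtain ⟨k⟩ := ‹Nonempty ι›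
  exact occTime_ne_top hcons hq hirr ⟨(0, k), by simp [upperLevels]⟩ _ _

/-- A finite excursion time in `(1, j)` equals a nonzero flow times this number. -/
lemma absTHat_ne_top [Nonempty ι] (hQ : Q = generator D W W' U U')
    (hD : D = Matrix.vecMulVec c r) (hcons : IsQMatrix Q) (hirr : IsIrreducible Q)
    (hq : ∀ x, Q x x < 0) (j : ι) : absTHat Q r j ≠ ∞ := by
  obtain ⟨i, k, hs, -⟩ := exists_base_phase hQ hD hcons hirr hq
  intro h
  have h1 := occTime_next_level_eq hQ hD hcons hq (a := (0, i)) le_rfl j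
  rw [h, ENNReal.mul_top hs] at h1
  exact occTime_ne_top hcons hq hirr (Set.singleton_nonempty _) _ _ h1

/-- Down to the level of `a` there are finitely many states; below it the excursion mass is
geometric. -/
lemma isPositiveRecurrent_of_absGamma_lt_one [Nonempty ι] [Finite ι]
    (hQ : Q = generator D W W' U U') (hD : D = Matrix.vecMulVec c r) (hcons : IsQMatrix Q)
    (hirr : IsIrreducible Q) (hq : ∀ x, Q x x < 0) (hγ : absGamma Q c r < 1) :
    IsPositiveRecurrent Q := by
  have := Fintype.ofFinite ι
  intro a
  have hfin : ∀ y, occTime Q {a} a y ≠ ∞ :=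
    occTime_ne_top hcons hq hirr (Set.singleton_nonempty a) a
  have hs : downFlow Q c a a.1 ≠ ∞ := by
    rw [downFlow, tsum_fintype]
    exact ENNReal.sum_ne_top.mpr fun i _ => ENNReal.mul_ne_top (hfin _) ENNReal.ofReal_ne_top
  rw [meanReturn_eq_tsum_occTime hq, ENNReal.tsum_prod', lt_top_iff_ne_top,
    ← Summable.sum_add_tsum_nat_add' (k := a.1 + 1) ENNReal.summable]
  refine ENNReal.add_ne_top.mpr ⟨ENNReal.sum_ne_top.mpr fun n _ => ?_, ?_⟩
  · rw [tsum_fintype]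
    exact ENNReal.sum_ne_top.mpr fun i _ => hfin _
  · have h : ∀ k j, occTime Q {a} a (k + (a.1 + 1), j) =
        absGamma Q c r ^ k * (downFlow Q c a a.1 * absTHat Q r j) := by
      intro k j
      have h1 : k + (a.1 + 1) = a.1 + k + 1 := by ring
      rw [h1, occTime_next_level_eq hQ hD hcons hq (Nat.le_add_right _ _),
        downFlow_add hQ hD hcons hq le_rfl]
      ring
    simp only [h, ENNReal.tsum_mul_left, ENNReal.tsum_mul_right, ENNReal.tsum_geometric]
    refine ENNReal.mul_ne_top (ENNReal.inv_ne_top.mpr (tsub_pos_of_lt hγ).ne') (ENNReal.mul_ne_top hs ?_)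
    rw [tsum_fintype]
    exact ENNReal.sum_ne_top.mpr fun j _ => absTHat_ne_top hQ hD hcons hirr hq j

/-- The states `(n + 1, k)` alone contribute a geometric series with nonzero coefficient to the
finite mean return time. -/
lemma absGamma_lt_one_of_isPositiveRecurrent [Nonempty ι] (hQ : Q = generator D W W' U U')
    (hD : D = Matrix.vecMulVec c r) (hcons : IsQMatrix Q) (hirr : IsIrreducible Q)
    (hq : ∀ x, Q x x < 0) (hpos : IsPositiveRecurrent Q) : absGamma Q c r < 1 := by
  obtain ⟨i, k, hs, ht⟩ := exists_base_phase hQ hD hcons hirr hq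
  have h := (hpos (0, i)).ne
  rw [meanReturn_eq_tsum_occTime hq] at h
  have h1 : ∑' n, absGamma Q c r ^ n * (downFlow Q c (0, i) 0 * absTHat Q r k) ≠ ∞ := by
    refine ne_top_of_le_ne_top h ?_
    have hinj : Function.Injective fun n : ℕ => (n + 1, k) := fun m n hmn => by simpa using hmn
    refine le_trans (ENNReal.tsum_le_tsum fun n => ?_)
      (ENNReal.tsum_comp_le_tsum_of_injective hinj _)
    have h2 := downFlow_add hQ hD hcons hq (a := (0, i)) le_rfl n
    rw [zero_add] at h2
    rw [occTime_next_level_eq hQ hD hcons hq (Nat.zero_le n), h2]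
    exact le_of_eq (by ring)
  rw [ENNReal.tsum_mul_right, ENNReal.tsum_geometric] at h1
  by_contra hγ
  rw [tsub_eq_zero_of_le (not_lt.mp hγ), ENNReal.inv_zero, ENNReal.top_mul (mul_ne_zero hs ht)] at h1
  exact h1 rfl

lemma exists_isStationary [Nonempty ι] (hQ : Q = generator D W W' U U')
    (hD : D = Matrix.vecMulVec c r) (hcons : IsQMatrix Q) (hirr : IsIrreducible Q)
    (hq : ∀ x, Q x x < 0) (hne : IsNonExplosive Q) (hpos : IsPositiveRecurrent Q) :
    ∃ p : ℕ × ι → ℝ, IsStationary Q p ∧ (Summable fun i => p (0, i) * c i) ∧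
      ∀ (n : ℕ) (j : ι),
        p (n + 1, j) = gamma Q c r ^ n * (∑' i, p (0, i) * c i) * tHat Q r j := by
  obtain ⟨i₀, k₀, hs, ht⟩ := exists_base_phase hQ hD hcons hirr hq
  obtain ⟨σ, hσ, hc, hr⟩ := exists_sign hQ hD hcons hirr
  set a : ℕ × ι := (0, i₀) with ha
  have htop := absTHat_ne_top hQ hD hcons hirr hq
  set M := ∑' y, occTime Q {a} a y with hM
  have hMt : M ≠ ∞ := by
    have h := (hpos a).ne
    rwa [meanReturn_eq_tsum_occTime hq] at h
  have hM0 : M ≠ 0 := fun h =>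
    ENNReal.inv_ne_zero.mpr (exitRate_ne_top Q a) (le_antisymm
      ((inv_exitRate_le_occTime a).trans (ENNReal.tsum_eq_zero.mp h a).le) zero_le)
  have hst : downFlow Q c a 0 ≠ ∞ := by
    intro h
    have h1 := occTime_next_level_eq hQ hD hcons hq (a := a) le_rfl k₀
    rw [show a.1 = 0 from rfl, h, ENNReal.top_mul ht] at h1
    exact occTime_ne_top hcons hq hirr (Set.singleton_nonempty _) _ _ h1
  have hmul : ∀ i, (M⁻¹ * occTime Q {a} a (0, i)).toReal * c i =
      σ * (M⁻¹ * (occTime Q {a} a (0, i) * ENNReal.ofReal |c i|)).toReal := by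
    intro i
    rw [← mul_assoc, ENNReal.toReal_mul (b := ENNReal.ofReal _),
      ENNReal.toReal_ofReal (abs_nonneg _)]
    conv_lhs => rw [hc i]
    ring
  have hflow : HasSum (fun i => (M⁻¹ * occTime Q {a} a (0, i)).toReal * c i)
      (σ * (M⁻¹ * downFlow Q c a 0).toReal) := by
    simp only [hmul]
    rw [downFlow, ← ENNReal.tsum_mul_left]
    refine hasSum_toReal_mul ?_
    rw [ENNReal.tsum_mul_left]
    exact ENNReal.mul_ne_top (ENNReal.inv_ne_top.mpr hM0) hst
  refine ⟨fun x => (M⁻¹ * occTime Q {a} a x).toReal, isStationary_of_subinvariant hq hne ?_ ?_,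
    hflow.summable, fun n j => ?_⟩
  · intro y
    simp only [mul_assoc]
    rw [ENNReal.tsum_mul_left]
    gcongr
    exact tsum_occTime_mul_rate_le hcons hq a y
  · rw [ENNReal.tsum_mul_left, ENNReal.inv_mul_cancel hM0 hMt]
  · have h2 := downFlow_add hQ hD hcons hq (a := a) le_rfl n
    rw [show a.1 + n = n from zero_add n] at h2
    rw [hflow.tsum_eq, gamma_eq hσ hc hr htop, tHat_eq hr (htop j)]
    simp only
    rw [occTime_next_level_eq hQ hD hcons hq (Nat.zero_le n), h2]
    simp only [ENNReal.toReal_mul, ENNReal.toReal_pow]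
    rw [show a.1 = 0 from rfl]
    -- The flow and `t̂` each carry one factor `σ`.
    linear_combination -(M⁻¹.toReal * (downFlow Q c a 0).toReal * (absGamma Q c r).toReal ^ n *
      (absTHat Q r j).toReal) * hσ

end ProductForm

end QSF

theorem mainTheorem2 {ι : Type*} [Countable ι] [Nonempty ι]
    (D W W' : Matrix ι ι ℝ) (U U' : ℕ → Matrix ι ι ℝ) (c r : ι → ℝ)
    (Q : Matrix (ℕ × ι) (ℕ × ι) ℝ) (hQ : Q = QSF.generator D W W' U U')
    (hD : D = Matrix.vecMulVec c r)
    (hcons : QSF.IsQMatrix Q) (hirr : QSF.IsIrreducible Q) (hnonexp : QSF.IsNonExplosive Q) :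
    -- the quantities in the statement are well defined
    (∀ i j, QSF.levelTime Q i j < ∞) ∧
    (∀ j, Summable fun i => r i * QSF.T Q i j) ∧
    -- sufficiency
    (Finite ι → QSF.gamma Q c r < 1 → QSF.IsPositiveRecurrent Q) ∧
    -- necessity
    (QSF.IsPositiveRecurrent Q →
      (Summable fun j => QSF.tHat Q r j * c j) ∧ QSF.gamma Q c r < 1) ∧
    -- the product form of the unique stationary distribution, at level `m = -(n + 1)`
    ((Finite ι ∧ QSF.gamma Q c r < 1) ∨ QSF.IsPositiveRecurrent Q →
      ∃ p : ℕ × ι → ℝ, QSF.IsStationary Q p ∧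
        (∀ p' : ℕ × ι → ℝ, QSF.IsStationary Q p' → p' = p) ∧
        (Summable fun i => p (0, i) * c i) ∧
        ∀ (n : ℕ) (j : ι),
          p (n + 1, j) = QSF.gamma Q c r ^ n * (∑' i, p (0, i) * c i) * QSF.tHat Q r j) := by
  have hq := QSF.diag_neg hcons hirr
  obtain ⟨σ, hσ, hc, hr⟩ := QSF.exists_sign hQ hD hcons hirr
  have htop := QSF.absTHat_ne_top hQ hD hcons hirr hq
  have hγ := QSF.gamma_eq hσ hc hr htop
  have hsuff : Finite ι → QSF.gamma Q c r < 1 → QSF.IsPositiveRecurrent Q := by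
    intro _ h
    have := Fintype.ofFinite ι
    refine QSF.isPositiveRecurrent_of_absGamma_lt_one hQ hD hcons hirr hq ?_
    -- Finiteness excludes that `gamma < 1` holds only through the default value of `toReal` at `∞`;
    -- this uses that there are finitely many phases.
    have hfin : QSF.absGamma Q c r ≠ ∞ := by
      rw [QSF.absGamma, tsum_fintype]
      exact ENNReal.sum_ne_top.mpr fun j _ => ENNReal.mul_ne_top (htop j) ENNReal.ofReal_ne_top
    rw [hγ] at h
    rwa [← ENNReal.toReal_lt_toReal hfin ENNReal.one_ne_top, ENNReal.toReal_one]
  refine ⟨fun i j => (QSF.levelTime_ne_top hcons hirr hq i j).lt_top, fun j => ?_, hsuff,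
    fun hpos => ?_, fun h => ?_⟩
  · simp only [QSF.mul_T_eq hr]
    exact (QSF.hasSum_toReal_mul (htop j)).summable
  · have h1 := QSF.absGamma_lt_one_of_isPositiveRecurrent hQ hD hcons hirr hq hpos
    refine ⟨?_, ?_⟩
    · simp only [QSF.tHat_mul_eq hσ hc hr (htop _)]
      exact ENNReal.summable_toReal h1.ne_top
    · rw [hγ, ← ENNReal.toReal_one]
      exact (ENNReal.toReal_lt_toReal h1.ne_top ENNReal.one_ne_top).mpr h1
  · have hpos : QSF.IsPositiveRecurrent Q := h.elim (fun h => hsuff h.1 h.2) id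
    obtain ⟨p, hp, h1, h2⟩ := QSF.exists_isStationary hQ hD hcons hirr hq hnonexp hpos
    exact ⟨p, hp, fun p' hp' => hp'.unique hirr hnonexp hp, h1, h2⟩
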